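/- **Setting.** In each slot $t=1,\dots,T$ an ad query $(v_t,x_t,q_t)$ is drawn i.i.d. from a distribution $\mathcal D$. Here $v_t\in[0,1]$ is the value, $x_t:[0,\infty)\to[0,1]$ is a non-decreasing allocation function with $x_t(0)=0$, and $q_t:[0,\infty)\to[0,1]$ is a non-decreasing payment function with $q_t(b)\le b$ and with $q_t(b)=0$ whenever $x_t(b)=0$; the expected payment is $p_t(b)=q_t(b)x_t(b)$. A (possibly randomized) online algorithm $\mathcal A$, which may know $T$ but not $\mathcal D$, chooses in slot $t$ a bid $b_t\ge 0$ depending on its internal randomness, on the past observations $(v_\tau,x_\tau(b_\tau),p_\tau(b_\tau))_{\tau<t}$ and on $v_t$. Put $$V_{\mathcal A}(\mathcal D,T)=\mathbb E\Big[\sum_{t=1}^T v_t x_t(b_t)\Big].$$ The algorithm satisfies the return-on-spend constraint (ROSC) under $\mathcal D$ if $$\mathbb E\Big[\sum_{t=1}^T p_t(b_t)\Big]\le \mathbb E\Big[\sum_{t=1}^T v_t x_t(b_t)\Big].$$ Let $V_{\mathsf{OPT}}(\mathcal D,T)$ be the supremum of $V_{\mathcal B}(\mathcal D,T)$ over all online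 algorithms $\mathcal B$ (which may be tailored to $\mathcal D$) that satisfy the ROSC under $\mathcal D$. For a class $\mathcal C$ of distributions let $$\mathcal R^{\mathcal C}_{\mathcal A}(T)=\sup_{\mathcal D\in\mathcal C}\big(V_{\mathsf{OPT}}(\mathcal D,T)-V_{\mathcal A}(\mathcal D,T)\big),$$ and write $\mathcal R_{\mathcal A}(T)$ when $\mathcal C$ consists of all distributions. **Theorem.** There is an absolute constant $c>0$ such that for every $T\ge1$ and every online algorithm $\mathcal A$: 1. if $\mathcal A$ satisfies the ROSC over horizon $T$ under every distribution $\mathcal D$, then $\mathcal R_{\mathcal A}(T)\ge cT$; that is, the regret of every online algorithm that strictly satisfies the ROSC is $\Omega(T)$; 2. the same holds within structured inputs: let $\mathcal C$ be the class of distributions for which $v_t\in\{0.5,0.9\}$ with probability $1/2$ each, the functions are almost surely of threshold type, $x_t(b)=\mathbf 1[b\ge\theta_t]$ and $p_t(b)=\theta_t\mathbf 1[b\ge\theta_t]$ for a random threshold $\theta_t\in(0,1]$, and hence satisfy Myerson's condition $p_t(b)=b\,x_t(b)-\int_0^b x_t(u)\,du$; if $\mathcal A$ satisfies the ROSC over horizon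 $T$ under every $\mathcal D\in\mathcal C$, then $\mathcal R^{\mathcal C}_{\mathcal A}(T)\ge cT$. -/

import Mathlib

open MeasureTheory
open scoped NNReal

noncomputable section

namespace AutoBidding

/-- The distribution `𝒟` of one ad query `(v, x, q)`, given as a random query on a probability
space: value `v ∈ [0,1]`, allocation function `x : [0,∞) → [0,1]` and payment function
`q : [0,∞) → [0,1]`. Measurability of `x` and `q` is joint in the outcome and the bid. -/
structure Input where
  Ω : Type
  mΩ : MeasurableSpace Ω
  P : Measure Ω
  isProb : IsProbabilityMeasure P
  v : Ω → ℝ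
  x : Ω → ℝ≥0 → ℝ
  q : Ω → ℝ≥0 → ℝ
  measurable_v : Measurable v
  measurable_x : Measurable (fun z : Ω × ℝ≥0 => x z.1 z.2)
  measurable_q : Measurable (fun z : Ω × ℝ≥0 => q z.1 z.2)
  v_mem : ∀ ω, v ω ∈ Set.Icc (0 : ℝ) 1
  x_mem : ∀ ω b, x ω b ∈ Set.Icc (0 : ℝ) 1
  x_mono : ∀ ω, Monotone (x ω)
  x_zero : ∀ ω, x ω 0 = 0
  q_mem : ∀ ω b, q ω b ∈ Set.Icc (0 : ℝ) 1
  q_mono : ∀ ω, Monotone (q ω)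
  q_eq_zero : ∀ ω b, x ω b = 0 → q ω b = 0
  q_le_bid : ∀ ω b, q ω b ≤ b

attribute [instance] Input.mΩ
attribute [instance] Input.isProb

/-- The expected payment function `p(b) = q(b) x(b)`. -/
def Input.p (D : Input) (ω : D.Ω) (b : ℝ≥0) : ℝ := D.q ω b * D.x ω b

/-- What is observed in a slot: `(v_t, x_t(b_t), p_t(b_t))`. -/
abbrev Obs : Type := ℝ × ℝ × ℝ

/-- A (possibly randomized) online algorithm. Slots are numbered `0, 1, 2, …`. The bid in slot `t`
depends on the private random seed, on the observations of slots `0, …, t-1`, and on the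
present value `v_t`. -/
structure OnlineAlgorithm where
  Seed : Type
  mSeed : MeasurableSpace Seed
  seedLaw : Measure Seed
  isProb : IsProbabilityMeasure seedLaw
  bid : (t : ℕ) → Seed → (Fin t → Obs) → ℝ → ℝ≥0
  measurable_bid : ∀ t : ℕ,
    Measurable (fun z : Seed × (Fin t → Obs) × ℝ => bid t z.1 z.2.1 z.2.2)

attribute [instance] OnlineAlgorithm.mSeed
attribute [instance] OnlineAlgorithm.isProb

namespace OnlineAlgorithm

/-- The observations made in slots `0, …, t-1` when the algorithm runs with seed `s` on the queries
`ω 0, ω 1, …`. -/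
def history (A : OnlineAlgorithm) (D : Input) (s : A.Seed) (ω : ℕ → D.Ω) :
    (t : ℕ) → (Fin t → Obs)
  | 0 => Fin.elim0
  | t + 1 =>
    Fin.snoc (α := fun _ => Obs) (A.history D s ω t)
      (D.v (ω t),
        D.x (ω t) (A.bid t s (A.history D s ω t) (D.v (ω t))),
        D.p (ω t) (A.bid t s (A.history D s ω t) (D.v (ω t))))

/-- The bid `b_t` made in slot `t`. -/
def bidAt (A : OnlineAlgorithm) (D : Input) (s : A.Seed) (ω : ℕ → D.Ω) (t : ℕ) : ℝ≥0 :=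
  A.bid t s (A.history D s ω t) (D.v (ω t))

/-- The joint law of the seed and of the i.i.d. sequence of queries with distribution `D`. -/
def law (A : OnlineAlgorithm) (D : Input) : Measure (A.Seed × (ℕ → D.Ω)) :=
  A.seedLaw.prod (Measure.infinitePi (fun _ : ℕ => D.P))

/-- The total expected accrued valuation `V_A(T) = 𝔼 ∑_{t} v_t x_t(b_t)`. -/
def totalValue (A : OnlineAlgorithm) (D : Input) (T : ℕ) : ℝ :=
  ∫ z, ∑ t ∈ Finset.range T, D.v (z.2 t) * D.x (z.2 t) (A.bidAt D z.1 z.2 t) ∂(A.law D)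

/-- The total expected payment `𝔼 ∑_{t} p_t(b_t)`. -/
def totalPayment (A : OnlineAlgorithm) (D : Input) (T : ℕ) : ℝ :=
  ∫ z, ∑ t ∈ Finset.range T, D.p (z.2 t) (A.bidAt D z.1 z.2 t) ∂(A.law D)

/-- The return-on-spend constraint over horizon `T` under the input distribution `D`. -/
def SatisfiesROSC (A : OnlineAlgorithm) (D : Input) (T : ℕ) : Prop :=
  A.totalPayment D T ≤ A.totalValue D T

end OnlineAlgorithm

/-- The benchmark `V_OPT(T)`: the optimal value over all algorithms that satisfy the constraint
under `D`; since `D` is fixed here, these may be tailored to `D`. -/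
def optValue (D : Input) (T : ℕ) : ℝ :=
  sSup {r : ℝ | ∃ B : OnlineAlgorithm, B.SatisfiesROSC D T ∧ r = B.totalValue D T}

/-- The regret of `A` over horizon `T`, the worst case being taken over the input distributions
in the class `𝒞`. -/
def regret (𝒞 : Set Input) (A : OnlineAlgorithm) (T : ℕ) : ℝ :=
  sSup {r : ℝ | ∃ D ∈ 𝒞, r = optValue D T - A.totalValue D T}

/-- Threshold type: there is a random threshold `θ ∈ (0,1]` such that a bid `b` wins iff `b ≥ θ`,
and then pays `θ`. -/
def Input.IsThreshold (D : Input) : Prop :=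
  ∃ θ : D.Ω → ℝ≥0, Measurable θ ∧ ∀ᵐ ω ∂D.P, 0 < θ ω ∧ θ ω ≤ 1 ∧ ∀ b : ℝ≥0,
    D.x ω b = (if θ ω ≤ b then 1 else 0) ∧
    D.p ω b = (if θ ω ≤ b then (θ ω : ℝ) else 0)

/-- Myerson's condition `p(b) = b x(b) - ∫_0^b x(u) du`. -/
def Input.IsMyerson (D : Input) : Prop :=
  ∀ᵐ ω ∂D.P, ∀ b : ℝ≥0,
    D.p ω b = b * D.x ω b - ∫ u in (0 : ℝ)..b, D.x ω u.toNNReal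

/-- The value is `0.5` or `0.9`, each with probability `1/2`. -/
def Input.IsTwoValued (D : Input) : Prop :=
  D.P {ω | D.v ω = 1 / 2} = 1 / 2 ∧ D.P {ω | D.v ω = 9 / 10} = 1 / 2

/-- Threshold inputs that satisfy Myerson's condition and have the two values `0.5` and `0.9`. -/
def structuredInputs : Set Input :=
  {D | D.IsThreshold ∧ D.IsMyerson ∧ D.IsTwoValued}

end AutoBidding

end

/-!
Put an algorithm in front of two inputs that differ only in the price of a rare query. In the second
input that query is a bargain, whose surplus pays for the queries priced above their value: winning
every slot costs, on average, at most what it earns. In the first input nothing is priced below its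
value, so the return-on-spend constraint can only hold if the algorithm almost surely wins no
overpriced query at all. Until the first bargain shows up, the two inputs look the same; an
algorithm that respects the constraint under the first one therefore wins no overpriced query under
the second one before that moment. If bargains have probability `1 / (8 T)`, then with probability
at least `7 / 8` none occurs within the horizon.
-/

namespace AutoBidding

namespace OnlineAlgorithm

instance isProbabilityMeasure_law (A : OnlineAlgorithm) (D : Input) :
    IsProbabilityMeasure (A.law D) :=
  inferInstanceAs (IsProbabilityMeasure (A.seedLaw.prod _))

section Run

variable (A : OnlineAlgorithm) (D : Input)

theorem measurable_query (t : ℕ) : Measurable fun z : A.Seed × (ℕ → D.Ω) => z.2 t :=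
  (measurable_pi_apply t).comp measurable_snd

variable {A D} in
theorem measurable_bidAt_of_measurable_history {t : ℕ}
    (h : Measurable fun z : A.Seed × (ℕ → D.Ω) => A.history D z.1 z.2 t) :
    Measurable fun z : A.Seed × (ℕ → D.Ω) => A.bidAt D z.1 z.2 t :=
  (A.measurable_bid t).comp
    (measurable_fst.prodMk (h.prodMk (D.measurable_v.comp (A.measurable_query D t))))

theorem measurable_history (t : ℕ) :
    Measurable fun z : A.Seed × (ℕ → D.Ω) => A.history D z.1 z.2 t := by
  induction t with
  | zero => exact measurable_pi_lambda _ fun i => i.elim0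
  | succ t ih =>
    have hquery := A.measurable_query D t
    have hquery_bid := hquery.prodMk (measurable_bidAt_of_measurable_history ih)
    have hx := D.measurable_x.comp hquery_bid
    have hq := D.measurable_q.comp hquery_bid
    refine measurable_pi_lambda _ <| Fin.lastCases ?_ fun i => ?_
    · simp only [history, Fin.snoc_last]
      exact (D.measurable_v.comp hquery).prodMk (hx.prodMk (hq.mul hx))
    · simp only [history, Fin.snoc_castSucc]
      exact (measurable_pi_apply i).comp ih

theorem measurable_bidAt (t : ℕ) :
    Measurable fun z : A.Seed × (ℕ → D.Ω) => A.bidAt D z.1 z.2 t :=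
  measurable_bidAt_of_measurable_history (A.measurable_history D t)

theorem integrable_comp_query_bidAt {g : D.Ω → ℝ≥0 → ℝ} {a b : ℝ}
    (hg : Measurable fun z : D.Ω × ℝ≥0 => g z.1 z.2) (hmem : ∀ ω c, g ω c ∈ Set.Icc a b) (t : ℕ) :
    Integrable (fun z => g (z.2 t) (A.bidAt D z.1 z.2 t)) (A.law D) :=
  .of_mem_Icc a b
    (hg.comp ((A.measurable_query D t).prodMk (A.measurable_bidAt D t))).aemeasurable
    (.of_forall fun _ => hmem _ _)

theorem measurePreserving_query (t : ℕ) :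
    MeasurePreserving (fun z : A.Seed × (ℕ → D.Ω) => z.2 t) (A.law D) D.P :=
  (measurePreserving_eval_infinitePi (fun _ : ℕ => D.P) t).comp measurePreserving_snd

variable {f : D.Ω → ℝ}

theorem integrable_comp_query (hf : Integrable f D.P) (t : ℕ) :
    Integrable (fun z => f (z.2 t)) (A.law D) :=
  (A.measurePreserving_query D t).integrable_comp_of_integrable hf

theorem integral_comp_query (hf : AEStronglyMeasurable f D.P) (t : ℕ) :
    ∫ z, f (z.2 t) ∂A.law D = ∫ ω, f ω ∂D.P := by
  have hquery := A.measurePreserving_query D t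
  rw [← hquery.map_eq] at hf ⊢
  exact (integral_map hquery.measurable.aemeasurable hf).symm

theorem integral_sum_comp_query (hf : Integrable f D.P) (T : ℕ) :
    ∫ z, ∑ t ∈ Finset.range T, f (z.2 t) ∂A.law D = T * ∫ ω, f ω ∂D.P := by
  rw [integral_finsetSum _ fun t _ => A.integrable_comp_query D hf t]
  simp only [A.integral_comp_query D hf.aestronglyMeasurable, Finset.sum_const, Finset.card_range,
    nsmul_eq_mul]

end Run

end OnlineAlgorithm

namespace Input

variable (D : Input)

theorem value_mem_Icc (ω : D.Ω) (b : ℝ≥0) : D.v ω * D.x ω b ∈ Set.Icc (0 : ℝ) 1 :=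
  ⟨mul_nonneg (D.v_mem ω).1 (D.x_mem ω b).1,
    mul_le_one₀ (D.v_mem ω).2 (D.x_mem ω b).1 (D.x_mem ω b).2⟩

theorem p_mem_Icc (ω : D.Ω) (b : ℝ≥0) : D.p ω b ∈ Set.Icc (0 : ℝ) 1 :=
  ⟨mul_nonneg (D.q_mem ω b).1 (D.x_mem ω b).1,
    mul_le_one₀ (D.q_mem ω b).2 (D.x_mem ω b).1 (D.x_mem ω b).2⟩

theorem measurable_value : Measurable fun z : D.Ω × ℝ≥0 => D.v z.1 * D.x z.1 z.2 :=
  (D.measurable_v.comp measurable_fst).mul D.measurable_x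

theorem measurable_p : Measurable fun z : D.Ω × ℝ≥0 => D.p z.1 z.2 :=
  D.measurable_q.mul D.measurable_x

theorem integrable_value (b : ℝ≥0) : Integrable (fun ω => D.v ω * D.x ω b) D.P :=
  .of_mem_Icc 0 1 (D.measurable_value.comp measurable_prodMk_right).aemeasurable
    (.of_forall fun ω => D.value_mem_Icc ω b)

theorem integrable_p (b : ℝ≥0) : Integrable (fun ω => D.p ω b) D.P :=
  .of_mem_Icc 0 1 (D.measurable_p.comp measurable_prodMk_right).aemeasurable
    (.of_forall fun ω => D.p_mem_Icc ω b)

end Input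

namespace OnlineAlgorithm

variable (A : OnlineAlgorithm) (D : Input) (T : ℕ)

/-- The value accrued in slot `t`, so that `totalValue` is the expected sum of these. -/
def slotValue (z : A.Seed × (ℕ → D.Ω)) (t : ℕ) : ℝ :=
  D.v (z.2 t) * D.x (z.2 t) (A.bidAt D z.1 z.2 t)

/-- The payment made in slot `t`, so that `totalPayment` is the expected sum of these. -/
def slotPayment (z : A.Seed × (ℕ → D.Ω)) (t : ℕ) : ℝ :=
  D.p (z.2 t) (A.bidAt D z.1 z.2 t)

theorem integrable_sum_slotValue :
    Integrable (fun z => ∑ t ∈ Finset.range T, A.slotValue D z t) (A.law D) :=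
  integrable_finsetSum _ fun t _ =>
    A.integrable_comp_query_bidAt D D.measurable_value D.value_mem_Icc t

theorem integrable_sum_slotPayment :
    Integrable (fun z => ∑ t ∈ Finset.range T, A.slotPayment D z t) (A.law D) :=
  integrable_finsetSum _ fun t _ =>
    A.integrable_comp_query_bidAt D D.measurable_p D.p_mem_Icc t

theorem totalValue_nonneg : 0 ≤ A.totalValue D T :=
  integral_nonneg fun _ => Finset.sum_nonneg fun _ _ => (D.value_mem_Icc _ _).1

variable {A D T}

theorem totalValue_le_of_ae_sum_slotValue_le {f : D.Ω → ℝ} (hf : Integrable f D.P)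
    (h : ∀ᵐ z ∂A.law D,
      ∑ t ∈ Finset.range T, A.slotValue D z t ≤ ∑ t ∈ Finset.range T, f (z.2 t)) :
    A.totalValue D T ≤ T * ∫ ω, f ω ∂D.P := by
  rw [← A.integral_sum_comp_query D hf]
  exact integral_mono_ae (A.integrable_sum_slotValue D T)
    (integrable_finsetSum _ fun t _ => A.integrable_comp_query D hf t) h

variable (A D T) in
theorem totalValue_le : A.totalValue D T ≤ T := by
  have hone : ∀ᵐ z ∂A.law D,
      ∑ t ∈ Finset.range T, A.slotValue D z t ≤ ∑ _t ∈ Finset.range T, (1 : ℝ) :=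
    .of_forall fun z => Finset.sum_le_sum fun t _ => (D.value_mem_Icc _ _).2
  simpa using totalValue_le_of_ae_sum_slotValue_le (integrable_const 1) hone

theorem SatisfiesROSC.ae_slotPayment_eq_slotValue (hA : A.SatisfiesROSC D T)
    (hD : ∀ ω b, D.v ω * D.x ω b ≤ D.p ω b) :
    ∀ᵐ z ∂A.law D, ∀ t < T, A.slotPayment D z t = A.slotValue D z t := by
  have hslot (z) (t : ℕ) : A.slotValue D z t ≤ A.slotPayment D z t := hD _ _
  have hsum (z) : ∑ t ∈ Finset.range T, A.slotValue D z t ≤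
      ∑ t ∈ Finset.range T, A.slotPayment D z t := Finset.sum_le_sum fun t _ => hslot z t
  have htotal : A.totalValue D T = A.totalPayment D T :=
    le_antisymm (integral_mono (A.integrable_sum_slotValue D T)
      (A.integrable_sum_slotPayment D T) hsum) hA
  have hae := (integral_eq_iff_of_ae_le (A.integrable_sum_slotValue D T)
    (A.integrable_sum_slotPayment D T) (.of_forall hsum)).1 htotal
  filter_upwards [hae] with z hz t ht
  exact ((Finset.sum_eq_sum_iff_of_le fun t _ => hslot z t).1 hz t (Finset.mem_range.2 ht)).symm

/-- The algorithm that bids `b` in every slot. -/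
noncomputable def constantBid (b : ℝ≥0) : OnlineAlgorithm where
  Seed := Unit
  mSeed := inferInstance
  seedLaw := Measure.dirac ()
  isProb := inferInstance
  bid _ _ _ _ := b
  measurable_bid _ := measurable_const

variable (D T) in
theorem totalValue_constantBid (b : ℝ≥0) :
    (constantBid b).totalValue D T = T * ∫ ω, D.v ω * D.x ω b ∂D.P :=
  (constantBid b).integral_sum_comp_query D (D.integrable_value b) T

variable (D T) in
theorem totalPayment_constantBid (b : ℝ≥0) :
    (constantBid b).totalPayment D T = T * ∫ ω, D.p ω b ∂D.P :=
  (constantBid b).integral_sum_comp_query D (D.integrable_p b) T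

end OnlineAlgorithm

section Regret

variable {D : Input} {T : ℕ}

theorem totalValue_le_optValue {B : OnlineAlgorithm} (hB : B.SatisfiesROSC D T) :
    B.totalValue D T ≤ optValue D T := by
  refine le_csSup ⟨T, ?_⟩ ⟨B, hB, rfl⟩
  rintro _ ⟨B, -, rfl⟩
  exact B.totalValue_le D T

theorem mul_integral_le_optValue {b : ℝ≥0}
    (hb : ∫ ω, D.p ω b ∂D.P ≤ ∫ ω, D.v ω * D.x ω b ∂D.P) :
    T * ∫ ω, D.v ω * D.x ω b ∂D.P ≤ optValue D T := by
  rw [← OnlineAlgorithm.totalValue_constantBid]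
  apply totalValue_le_optValue
  rw [OnlineAlgorithm.SatisfiesROSC, OnlineAlgorithm.totalPayment_constantBid,
    OnlineAlgorithm.totalValue_constantBid]
  gcongr

theorem optValue_le (D : Input) (T : ℕ) : optValue D T ≤ T := by
  refine Real.sSup_le ?_ T.cast_nonneg
  rintro _ ⟨B, -, rfl⟩
  exact B.totalValue_le D T

theorem optValue_sub_totalValue_le_regret {𝒞 : Set Input} (hD : D ∈ 𝒞) (A : OnlineAlgorithm) :
    optValue D T - A.totalValue D T ≤ regret 𝒞 A T := by
  refine le_csSup ⟨T, ?_⟩ ⟨D, hD, rfl⟩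
  rintro _ ⟨D, -, rfl⟩
  linarith [optValue_le D T, A.totalValue_nonneg D T]

end Regret

theorem monotone_ite_le {α β : Type*} [Preorder α] [DecidableLE α] [Zero β] [Preorder β] (a : α)
    {c : β} (hc : 0 ≤ c) : Monotone fun b => if a ≤ b then c else 0 := by
  intro b b' hbb'
  dsimp only
  split_ifs with h h'
  · exact le_rfl
  · exact absurd (h.trans hbb') h'
  · exact hc
  · exact le_rfl

theorem intervalIntegral_threshold {θ : ℝ≥0} (hθ : 0 < θ) (b : ℝ≥0) :
    ∫ u in (0 : ℝ)..b, (if θ ≤ u.toNNReal then (1 : ℝ) else 0) = max ((b : ℝ) - θ) 0 := by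
  have hindicator (u : ℝ) :
      (if θ ≤ u.toNNReal then (1 : ℝ) else 0) = (Set.Ici (θ : ℝ)).indicator 1 u := by
    simp [Set.indicator_apply, Real.le_toNNReal_iff_coe_le' hθ]
  have hinter : Set.Ioc (0 : ℝ) b ∩ Set.Ici (θ : ℝ) = Set.Icc (θ : ℝ) b := by
    ext u
    have : (0 : ℝ) < θ := hθ
    simp only [Set.mem_inter_iff, Set.mem_Ioc, Set.mem_Ici, Set.mem_Icc]
    constructor
    · exact fun h => ⟨h.2, h.1.2⟩
    · exact fun h => ⟨⟨this.trans_le h.1, h.2⟩, h.1⟩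
  simp only [hindicator]
  rw [intervalIntegral.integral_of_le b.coe_nonneg, setIntegral_indicator measurableSet_Ici, hinter]
  simp

theorem integrable_coe_Icc {Ω : Type*} [MeasurableSpace Ω] {P : Measure Ω} [IsFiniteMeasure P]
    {a b : ℝ} {v : Ω → Set.Icc a b} (hv : Measurable v) : Integrable (fun ω => (v ω : ℝ)) P :=
  .of_mem_Icc a b hv.subtype_val.aemeasurable (.of_forall fun ω => (v ω).2)

/-- The queries priced above their value. -/
def overpriced {Ω : Type*} (v : Ω → Set.Icc (0 : ℝ) 1) (θ : Ω → Set.Ioc (0 : ℝ≥0) 1) : Set Ω :=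
  {ω | (v ω : ℝ) < (θ ω : ℝ≥0)}

theorem measurableSet_overpriced {Ω : Type*} [MeasurableSpace Ω] {v : Ω → Set.Icc (0 : ℝ) 1}
    (hv : Measurable v) {θ : Ω → Set.Ioc (0 : ℝ≥0) 1} (hθ : Measurable θ) :
    MeasurableSet (overpriced v θ) :=
  measurableSet_lt hv.subtype_val (measurable_coe_nnreal_real.comp hθ.subtype_val)

/-- The input whose query has value `v ω` and is won, at the price `θ ω`, by the bids that are at
least `θ ω`, where `ω` is distributed according to `P`. -/
noncomputable abbrev thresholdInput {Ω : Type} [mΩ : MeasurableSpace Ω] (P : Measure Ω)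
    [isProb : IsProbabilityMeasure P] {v : Ω → Set.Icc (0 : ℝ) 1} (hv : Measurable v)
    {θ : Ω → Set.Ioc (0 : ℝ≥0) 1} (hθ : Measurable θ) : Input where
  Ω := Ω
  mΩ := mΩ
  P := P
  isProb := isProb
  v ω := v ω
  x ω b := if (θ ω : ℝ≥0) ≤ b then 1 else 0
  q ω b := if (θ ω : ℝ≥0) ≤ b then (θ ω : ℝ≥0) else 0
  measurable_v := hv.subtype_val
  measurable_x := .ite (measurableSet_le (hθ.subtype_val.comp measurable_fst) measurable_snd)
    measurable_const measurable_const
  measurable_q := .ite (measurableSet_le (hθ.subtype_val.comp measurable_fst) measurable_snd)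
    (measurable_coe_nnreal_real.comp (hθ.subtype_val.comp measurable_fst)) measurable_const
  v_mem ω := (v ω).2
  x_mem ω b := by split_ifs <;> simp
  x_mono ω := monotone_ite_le _ zero_le_one
  x_zero ω := if_neg (θ ω).2.1.not_ge
  q_mem ω b := by
    split_ifs
    · exact ⟨NNReal.coe_nonneg _, (θ ω).2.2⟩
    · simp
  q_mono ω := monotone_ite_le _ (NNReal.coe_nonneg _)
  q_eq_zero ω b h := if_neg fun hwin => one_ne_zero ((if_pos hwin).symm.trans h)
  q_le_bid ω b := by
    split_ifs with h
    · exact h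
    · exact b.coe_nonneg

section Threshold

variable {Ω : Type} [MeasurableSpace Ω] (P : Measure Ω) [IsProbabilityMeasure P]
  {v : Ω → Set.Icc (0 : ℝ) 1} (hv : Measurable v) {θ θ₀ θ₁ : Ω → Set.Ioc (0 : ℝ≥0) 1}
  (hθ : Measurable θ) (hθ₀ : Measurable θ₀) (hθ₁ : Measurable θ₁)

theorem thresholdInput_value (ω : Ω) (b : ℝ≥0) :
    (thresholdInput P hv hθ).v ω * (thresholdInput P hv hθ).x ω b =
      if (θ ω : ℝ≥0) ≤ b then (v ω : ℝ) else 0 := by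
  simp

theorem thresholdInput_p (ω : Ω) (b : ℝ≥0) :
    (thresholdInput P hv hθ).p ω b = if (θ ω : ℝ≥0) ≤ b then ((θ ω : ℝ≥0) : ℝ) else 0 := by
  simp only [Input.p, ite_zero_mul_ite_zero, and_self, mul_one]

theorem isThreshold_thresholdInput : (thresholdInput P hv hθ).IsThreshold :=
  ⟨fun ω => θ ω, hθ.subtype_val, .of_forall fun ω =>
    ⟨(θ ω).2.1, (θ ω).2.2, fun b => ⟨rfl, thresholdInput_p P hv hθ ω b⟩⟩⟩

theorem isMyerson_thresholdInput : (thresholdInput P hv hθ).IsMyerson := by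
  refine .of_forall fun ω b => ?_
  rw [thresholdInput_p, intervalIntegral_threshold (θ ω).2.1]
  dsimp only
  split_ifs with hwin
  · rw [max_eq_left (sub_nonneg.2 (NNReal.coe_le_coe.2 hwin))]
    ring
  · rw [max_eq_right (sub_nonpos.2 (NNReal.coe_le_coe.2 (not_le.1 hwin).le))]
    ring

variable {P hv hθ hθ₀ hθ₁} {A : OnlineAlgorithm} {T : ℕ}

theorem mul_integral_le_optValue_thresholdInput
    (h : ∫ ω, ((θ ω : ℝ≥0) : ℝ) ∂P ≤ ∫ ω, (v ω : ℝ) ∂P) :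
    T * ∫ ω, (v ω : ℝ) ∂P ≤ optValue (thresholdInput P hv hθ) T := by
  have hvalue (ω : Ω) : (thresholdInput P hv hθ).v ω * (thresholdInput P hv hθ).x ω 1 = v ω :=
    (thresholdInput_value P hv hθ ω 1).trans (if_pos (θ ω).2.2)
  have hp (ω : Ω) : (thresholdInput P hv hθ).p ω 1 = (θ ω : ℝ≥0) :=
    (thresholdInput_p P hv hθ ω 1).trans (if_pos (θ ω).2.2)
  have hopt := mul_integral_le_optValue (D := thresholdInput P hv hθ) (T := T) (b := 1)
  simp only [hvalue, hp] at hopt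
  exact hopt h

theorem history_thresholdInput_congr {s : A.Seed} {ω : ℕ → Ω} {t : ℕ}
    (h : ∀ τ < t, θ₀ (ω τ) = θ₁ (ω τ)) :
    A.history (thresholdInput P hv hθ₀) s ω t = A.history (thresholdInput P hv hθ₁) s ω t := by
  induction t with
  | zero => rfl
  | succ t ih =>
    simp only [OnlineAlgorithm.history, thresholdInput_p, h t t.lt_succ_self,
      ih fun τ hτ => h τ (hτ.trans t.lt_succ_self)]

theorem slotValue_thresholdInput_congr {z : A.Seed × (ℕ → Ω)} {t : ℕ}
    (h : ∀ τ ≤ t, θ₀ (z.2 τ) = θ₁ (z.2 τ)) :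
    A.slotValue (thresholdInput P hv hθ₀) z t = A.slotValue (thresholdInput P hv hθ₁) z t := by
  rw [OnlineAlgorithm.slotValue, OnlineAlgorithm.slotValue, thresholdInput_value,
    thresholdInput_value, OnlineAlgorithm.bidAt, OnlineAlgorithm.bidAt,
    history_thresholdInput_congr (hθ₁ := hθ₁) fun τ hτ => h τ hτ.le, h t le_rfl]

theorem slotValue_le_indicator_of_slotPayment_eq {z : A.Seed × (ℕ → Ω)} {t : ℕ}
    (h : A.slotPayment (thresholdInput P hv hθ) z t = A.slotValue (thresholdInput P hv hθ) z t) :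
    A.slotValue (thresholdInput P hv hθ) z t ≤
      (overpriced v θ)ᶜ.indicator (fun ω => (v ω : ℝ)) (z.2 t) := by
  rw [OnlineAlgorithm.slotPayment, OnlineAlgorithm.slotValue, thresholdInput_p,
    thresholdInput_value] at h
  rw [OnlineAlgorithm.slotValue, thresholdInput_value]
  split_ifs at h ⊢ with hwin
  · rw [Set.indicator_of_mem]
    exact h.le.not_gt
  · exact Set.indicator_nonneg (fun ω _ => (v ω).2.1) _

theorem ae_slotValue_thresholdInput_le (hA : A.SatisfiesROSC (thresholdInput P hv hθ₀) T)
    (hle : ∀ ω, (v ω : ℝ) ≤ (θ₀ ω : ℝ≥0)) :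
    ∀ᵐ z ∂A.law (thresholdInput P hv hθ₁), ∀ t < T, A.slotValue (thresholdInput P hv hθ₁) z t ≤
      (overpriced v θ₀)ᶜ.indicator (fun ω => (v ω : ℝ)) (z.2 t) +
        ∑ τ ∈ Finset.range T, {ω | θ₀ ω ≠ θ₁ ω}.indicator (1 : Ω → ℝ) (z.2 τ) := by
  have hloss (ω : Ω) (b : ℝ≥0) : (thresholdInput P hv hθ₀).v ω * (thresholdInput P hv hθ₀).x ω b ≤
      (thresholdInput P hv hθ₀).p ω b := by
    rw [thresholdInput_value, thresholdInput_p]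
    split_ifs
    exacts [hle ω, le_rfl]
  have heq : ∀ᵐ z ∂A.law (thresholdInput P hv hθ₁), ∀ t < T,
      A.slotPayment (thresholdInput P hv hθ₀) z t = A.slotValue (thresholdInput P hv hθ₀) z t :=
    hA.ae_slotPayment_eq_slotValue hloss
  filter_upwards [heq] with z hz t ht
  have hdiff_nonneg (ω : Ω) : 0 ≤ {ω | θ₀ ω ≠ θ₁ ω}.indicator (1 : Ω → ℝ) ω :=
    Set.indicator_nonneg (fun _ _ => zero_le_one) ω
  by_cases hagree : ∀ τ ≤ t, θ₀ (z.2 τ) = θ₁ (z.2 τ)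
  · rw [← slotValue_thresholdInput_congr (hθ₀ := hθ₀) hagree]
    exact (slotValue_le_indicator_of_slotPayment_eq (hz t ht)).trans
      (le_add_of_nonneg_right (Finset.sum_nonneg fun _ _ => hdiff_nonneg _))
  · push Not at hagree
    obtain ⟨τ, hτ, hne⟩ := hagree
    calc A.slotValue (thresholdInput P hv hθ₁) z t
      _ ≤ 1 := (Input.value_mem_Icc _ _ _).2
      _ = {ω | θ₀ ω ≠ θ₁ ω}.indicator (1 : Ω → ℝ) (z.2 τ) :=
        (Set.indicator_of_mem (s := {ω | θ₀ ω ≠ θ₁ ω}) hne 1).symm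
      _ ≤ ∑ τ ∈ Finset.range T, {ω | θ₀ ω ≠ θ₁ ω}.indicator (1 : Ω → ℝ) (z.2 τ) :=
        Finset.single_le_sum (fun _ _ => hdiff_nonneg _) (Finset.mem_range.2 (hτ.trans_lt ht))
      _ ≤ _ := le_add_of_nonneg_left (Set.indicator_nonneg (fun ω _ => (v ω).2.1) _)

theorem totalValue_thresholdInput_le (hA : A.SatisfiesROSC (thresholdInput P hv hθ₀) T)
    (hle : ∀ ω, (v ω : ℝ) ≤ (θ₀ ω : ℝ≥0)) :
    A.totalValue (thresholdInput P hv hθ₁) T ≤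
      T * (∫ ω in (overpriced v θ₀)ᶜ, (v ω : ℝ) ∂P + T * P.real {ω | θ₀ ω ≠ θ₁ ω}) := by
  have hmeas_changed : MeasurableSet {ω | θ₀ ω ≠ θ₁ ω} := by
    simp only [ne_eq, Subtype.ext_iff]
    exact (measurableSet_eq_fun hθ₀.subtype_val hθ₁.subtype_val).compl
  have hint_value : Integrable ((overpriced v θ₀)ᶜ.indicator fun ω => (v ω : ℝ)) P :=
    (integrable_coe_Icc hv).indicator (measurableSet_overpriced hv hθ₀).compl
  have hint_changed : Integrable (fun ω => T * {ω | θ₀ ω ≠ θ₁ ω}.indicator (1 : Ω → ℝ) ω) P :=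
    ((integrable_const 1).indicator hmeas_changed).const_mul _
  have hbound : A.totalValue (thresholdInput P hv hθ₁) T ≤
      T * ∫ ω, ((overpriced v θ₀)ᶜ.indicator (fun ω => (v ω : ℝ)) ω +
        T * {ω | θ₀ ω ≠ θ₁ ω}.indicator (1 : Ω → ℝ) ω) ∂P := by
    refine OnlineAlgorithm.totalValue_le_of_ae_sum_slotValue_le (hint_value.add hint_changed) ?_
    filter_upwards [ae_slotValue_thresholdInput_le hA hle] with z hz
    refine (Finset.sum_le_sum fun t ht => hz t (Finset.mem_range.1 ht)).trans_eq ?_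
    simp only [Finset.sum_add_distrib, Finset.sum_const, Finset.card_range, nsmul_eq_mul,
      Finset.mul_sum]
  rwa [integral_add hint_value hint_changed, integral_const_mul,
    integral_indicator (measurableSet_overpriced hv hθ₀).compl,
    integral_indicator_one hmeas_changed] at hbound

theorem mul_le_optValue_sub_totalValue_thresholdInput
    (hA : A.SatisfiesROSC (thresholdInput P hv hθ₀) T) (hle : ∀ ω, (v ω : ℝ) ≤ (θ₀ ω : ℝ≥0))
    (hθ₁v : ∫ ω, ((θ₁ ω : ℝ≥0) : ℝ) ∂P ≤ ∫ ω, (v ω : ℝ) ∂P) :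
    T * (∫ ω in overpriced v θ₀, (v ω : ℝ) ∂P - T * P.real {ω | θ₀ ω ≠ θ₁ ω}) ≤
      optValue (thresholdInput P hv hθ₁) T - A.totalValue (thresholdInput P hv hθ₁) T := by
  have hopt := mul_integral_le_optValue_thresholdInput (T := T) (hv := hv) (hθ := hθ₁) hθ₁v
  have hval := totalValue_thresholdInput_le (hθ₁ := hθ₁) hA hle
  rw [← integral_add_compl (measurableSet_overpriced hv hθ₀) (integrable_coe_Icc hv)] at hopt
  linarith

end Threshold

/-- The three kinds of query in the hard inputs: low value, high value at a price that depends on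
the input, and high value at a price equal to the value. -/
inductive QueryKind
  | low
  | bargain
  | high
  deriving DecidableEq

namespace QueryKind

instance : Fintype QueryKind where
  elems := {low, bargain, high}
  complete k := by cases k <;> decide

instance : MeasurableSpace QueryKind := ⊤

instance : DiscreteMeasurableSpace QueryKind := ⟨fun _ => trivial⟩

theorem sum_univ {M : Type*} [AddCommMonoid M] (f : QueryKind → M) :
    ∑ k, f k = f low + f bargain + f high := by
  change ∑ k ∈ {low, bargain, high}, f k = _
  rw [Finset.sum_insert (by decide), Finset.sum_pair (by decide), add_assoc]

/-- The value of a query. -/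
noncomputable def value : QueryKind → Set.Icc (0 : ℝ) 1
  | low => ⟨1 / 2, by norm_num⟩
  | bargain | high => ⟨9 / 10, by norm_num⟩

end QueryKind

section HardInput

open QueryKind
open scoped ENNReal

theorem coe_le_two_inv_of_le_quarter {ε : ℝ≥0} (hε : ε ≤ 1 / 4) : (ε : ℝ≥0∞) ≤ 2⁻¹ := by
  rw [← ENNReal.coe_two, ← ENNReal.coe_inv two_ne_zero, ENNReal.coe_le_coe]
  exact hε.trans (by norm_num [← NNReal.coe_le_coe])

variable {ε : ℝ≥0} (hε : ε ≤ 1 / 4)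

/-- The law of the kind of a query when bargains have probability `ε`. -/
noncomputable def kindLaw : PMF QueryKind :=
  .ofFintype
    (fun
      | low => 2⁻¹
      | bargain => ε
      | high => 2⁻¹ - ε)
    (by
      rw [sum_univ, add_assoc, add_tsub_cancel_of_le (coe_le_two_inv_of_le_quarter hε),
        ENNReal.inv_two_add_inv_two])

theorem integral_kindLaw (f : QueryKind → ℝ) :
    ∫ k, f k ∂(kindLaw hε).toMeasure =
      1 / 2 * f low + ε * f bargain + (1 / 2 - ε) * f high := by
  rw [PMF.integral_eq_sum, sum_univ]
  simp [kindLaw, ENNReal.toReal_sub_of_le (coe_le_two_inv_of_le_quarter hε)]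

theorem kindLaw_toMeasure_low : (kindLaw hε).toMeasure {low} = 1 / 2 := by
  rw [PMF.toMeasure_apply_singleton _ _ .of_discrete, one_div]
  rfl

theorem kindLaw_toMeasure_bargain : (kindLaw hε).toMeasure {bargain} = ε :=
  PMF.toMeasure_apply_singleton _ _ .of_discrete

/-- The price of a query, as a function of the price `β` of bargains. The excess `8 / 5 * ε` over
the value `1 / 2` is what a surplus of `4 / 5` on every bargain pays for:
`1 / 2 * (8 / 5 * ε) = ε * (4 / 5)`. -/
noncomputable def kindThreshold (β : Set.Ioc (0 : ℝ≥0) 1) : QueryKind → Set.Ioc (0 : ℝ≥0) 1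
  | low => ⟨1 / 2 + 8 / 5 * ε, by positivity, by
      have : (ε : ℝ) ≤ 1 / 4 := by exact_mod_cast hε
      rw [← NNReal.coe_le_coe]
      push_cast
      linarith⟩
  | bargain => β
  | high => ⟨9 / 10, by norm_num, by norm_num [← NNReal.coe_le_coe]⟩

/-- The input in which bargains have probability `ε` and price `β`. -/
noncomputable abbrev hardInput (β : Set.Ioc (0 : ℝ≥0) 1) : Input :=
  thresholdInput (kindLaw hε).toMeasure (v := value) .of_discrete (θ := kindThreshold hε β)
    .of_discrete

theorem isTwoValued_hardInput (β : Set.Ioc (0 : ℝ≥0) 1) : (hardInput hε β).IsTwoValued := by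
  have hlow : {k | (value k : ℝ) = 1 / 2} = {low} := by
    ext k
    cases k <;> grind [value]
  have hhigh : {k | (value k : ℝ) = 9 / 10} = {low}ᶜ := by
    ext k
    cases k <;> grind [value]
  refine ⟨?_, ?_⟩
  · exact (congrArg _ hlow).trans (kindLaw_toMeasure_low hε)
  · refine (congrArg _ hhigh).trans ?_
    rw [prob_compl_eq_one_sub .of_discrete, kindLaw_toMeasure_low, one_div,
      ENNReal.one_sub_inv_two]

theorem hardInput_mem_structuredInputs (β : Set.Ioc (0 : ℝ≥0) 1) :
    hardInput hε β ∈ structuredInputs :=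
  ⟨isThreshold_thresholdInput .., isMyerson_thresholdInput .., isTwoValued_hardInput hε β⟩

theorem value_le_kindThreshold {β : Set.Ioc (0 : ℝ≥0) 1} (hβ : 9 / 10 ≤ (β : ℝ≥0))
    (k : QueryKind) : (value k : ℝ) ≤ (kindThreshold hε β k : ℝ≥0) := by
  cases k
  · simp [value, kindThreshold]
  · simpa [value, kindThreshold, ← NNReal.coe_le_coe] using hβ
  · simp [value, kindThreshold]

theorem integral_kindThreshold_le_integral_value {β : Set.Ioc (0 : ℝ≥0) 1}
    (hβ : (β : ℝ≥0) ≤ 1 / 10) :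
    ∫ k, ((kindThreshold hε β k : ℝ≥0) : ℝ) ∂(kindLaw hε).toMeasure ≤
      ∫ k, (value k : ℝ) ∂(kindLaw hε).toMeasure := by
  have hβ' : (ε : ℝ) * (β : ℝ≥0) ≤ ε * (1 / 10) := by
    gcongr
    simpa [← NNReal.coe_le_coe] using hβ
  rw [integral_kindLaw, integral_kindLaw]
  simp only [kindThreshold, value]
  push_cast
  linarith

theorem overpriced_kindThreshold (hε₀ : 0 < ε) {β : Set.Ioc (0 : ℝ≥0) 1}
    (hβ : (β : ℝ≥0) ≤ 9 / 10) : overpriced value (kindThreshold hε β) = {low} := by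
  ext k
  cases k
  · simp [overpriced, value, kindThreshold, hε₀]
  · simpa [overpriced, value, kindThreshold, ← NNReal.coe_le_coe] using hβ
  · simp [overpriced, value, kindThreshold]

theorem setIntegral_value_low : ∫ k in {low}, (value k : ℝ) ∂(kindLaw hε).toMeasure = 1 / 4 := by
  rw [integral_singleton, measureReal_def, kindLaw_toMeasure_low]
  norm_num [value]

theorem real_kindThreshold_ne_le (β₀ β₁ : Set.Ioc (0 : ℝ≥0) 1) :
    (kindLaw hε).toMeasure.real {k | kindThreshold hε β₀ k ≠ kindThreshold hε β₁ k} ≤ ε := by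
  have hsubset : {k | kindThreshold hε β₀ k ≠ kindThreshold hε β₁ k} ⊆ {bargain} := by
    rintro (_ | _ | _) hne
    exacts [absurd rfl hne, rfl, absurd rfl hne]
  refine (measureReal_mono hsubset).trans_eq ?_
  rw [measureReal_def, kindLaw_toMeasure_bargain, ENNReal.coe_toReal]

theorem mul_le_optValue_sub_totalValue_hardInput (hε₀ : 0 < ε) {β₀ β₁ : Set.Ioc (0 : ℝ≥0) 1}
    (hβ₀ : (β₀ : ℝ≥0) = 9 / 10) (hβ₁ : (β₁ : ℝ≥0) ≤ 1 / 10) {A : OnlineAlgorithm} {T : ℕ}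
    (hA : A.SatisfiesROSC (hardInput hε β₀) T) :
    T * (1 / 4 - T * (ε : ℝ)) ≤
      optValue (hardInput hε β₁) T - A.totalValue (hardInput hε β₁) T := by
  refine le_trans ?_ (mul_le_optValue_sub_totalValue_thresholdInput hA
    (value_le_kindThreshold hε hβ₀.ge) (integral_kindThreshold_le_integral_value hε hβ₁))
  rw [overpriced_kindThreshold hε hε₀ hβ₀.le, setIntegral_value_low]
  gcongr
  exact real_kindThreshold_ne_le hε β₀ β₁

end HardInput

end AutoBidding

theorem mainTheorem1_general {T : ℕ} (hT : 1 ≤ T) :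
    ∃ D₀ ∈ AutoBidding.structuredInputs, ∃ D₁ ∈ AutoBidding.structuredInputs,
      ∀ A : AutoBidding.OnlineAlgorithm, A.SatisfiesROSC D₀ T →
        1 / 8 * (T : ℝ) ≤ AutoBidding.optValue D₁ T - A.totalValue D₁ T := by
  have hT₀ : (0 : ℝ) < T := by exact_mod_cast hT
  have hε : (1 / (8 * T) : ℝ≥0) ≤ 1 / 4 := by
    have : (1 : ℝ≥0) ≤ T := by exact_mod_cast hT
    gcongr
    linarith
  let fair : Set.Ioc (0 : ℝ≥0) 1 := ⟨9 / 10, by norm_num, by norm_num [← NNReal.coe_le_coe]⟩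
  let bargain : Set.Ioc (0 : ℝ≥0) 1 := ⟨1 / 10, by norm_num, by norm_num [← NNReal.coe_le_coe]⟩
  refine ⟨AutoBidding.hardInput hε fair, AutoBidding.hardInput_mem_structuredInputs hε fair,
    AutoBidding.hardInput hε bargain, AutoBidding.hardInput_mem_structuredInputs hε bargain,
    fun A hA => ?_⟩
  have hregret := AutoBidding.mul_le_optValue_sub_totalValue_hardInput hε (by positivity)
    (β₁ := bargain) rfl le_rfl hA
  refine le_of_eq_of_le ?_ hregret
  push_cast
  field_simp
  norm_num

theorem mainTheorem1 :
    ∃ c : ℝ, 0 < c ∧ ∀ T : ℕ, 1 ≤ T → ∀ A : AutoBidding.OnlineAlgorithm,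
      ((∀ D : AutoBidding.Input, A.SatisfiesROSC D T) →
        c * (T : ℝ) ≤ AutoBidding.regret Set.univ A T) ∧
      ((∀ D ∈ AutoBidding.structuredInputs, A.SatisfiesROSC D T) →
        c * (T : ℝ) ≤ AutoBidding.regret AutoBidding.structuredInputs A T) := by
  refine ⟨1 / 8, by norm_num, fun T hT A => ?_⟩
  obtain ⟨D₀, hD₀, D₁, hD₁, hregret⟩ := mainTheorem1_general hT
  exact ⟨fun h => (hregret A (h D₀)).trans
      (AutoBidding.optValue_sub_totalValue_le_regret (Set.mem_univ D₁) A),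
    fun h => (hregret A (h D₀ hD₀)).trans (AutoBidding.optValue_sub_totalValue_le_regret hD₁ A)⟩
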